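/- **Proposition 3.10.** Let $\mathbb H$ be the quaternions and let $V$ be a two-sided quaternionic Banach space: a real Banach space with commuting left and right multiplications by $\mathbb H$ which are continuous (for instance $\|qv\|=\|vq\|=|q|\,\|v\|$) and which, for real scalars, both coincide with the real scalar multiplication of $V$. Let $T:\mathcal D(T)\to V$ be a (single valued, possibly unbounded) right linear or left linear operator, whose domain $\mathcal D(T)\subseteq V$ is a right, respectively left, $\mathbb H$-linear subspace. Sums and products of operators have their maximal domains, $\mathcal D(A+B)=\mathcal D(A)\cap\mathcal D(B)$ and $\mathcal D(BA)=\{v\in\mathcal D(A): Av\in\mathcal D(B)\}$; $T^0=\mathcal I$ on $V$ and $T^{k+1}=T\,T^k$. The inverse of an injective operator is defined on its range. A quaternionic polynomial $P(q)=\sum_{\ell=0}^n a_\ell q^\ell$ is *intrinsic* if $P(\mathbb C_i)\subset\mathbb C_i$ for every $i\in\mathbb H$ with $i^2=-1$, where $\mathbb C_i=\{u+iv:u,v\in\mathbb R\}$ (equivalently, its coefficients are real). For such $P$ of degree $n$ put $P(T)=\sum_{\ell=0}^n a_\ell T^\ell$ with $\mathcal D(P(T))=\mathcal D(T^n)$;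 for $P=0$ let $P(T)=0$ on $V$. For an operator $A$ linear on the same side as $T$, let $\rho_S(A)$ be the set of all $s\in\mathbb H$ for which $A^2-2\operatorname{Re}(s)A+|s|^2\mathcal I:\mathcal D(A^2)\to V$ is bijective with a bounded inverse $V\to V$, and let $\sigma_S(A)=\mathbb H\setminus\rho_S(A)$. Let $P$ and $Q$ be intrinsic polynomials. Then: (i) If $P\neq0$, then $P(T)Q(T)=(PQ)(T)$, with equality of domains. (ii) If $P(T)$ is injective and $Q\neq0$, then $$\mathcal D(P(T)^{-1})\cap\mathcal D(Q(T))\subset\mathcal D(P(T)^{-1}Q(T))\cap\mathcal D(Q(T)P(T)^{-1})$$ and $P(T)^{-1}Q(T)v=Q(T)P(T)^{-1}v$ for all $v\in\mathcal D(Q(T))\cap\mathcal D(P(T)^{-1})$. (iii) Suppose that $T$ is closed and $\rho_S(T)\neq\emptyset$. Then $P(T)$ is closed. If, moreover, $P$ is non-constant or $\sigma_S(T)\neq\emptyset$, then $P(\sigma_S(T))=\sigma_S(P(T))$. -/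

import Mathlib

open scoped Quaternion Polynomial

/-! ### Quaternionic imaginary units, slices, intrinsic polynomials -/

/-- The sphere `𝕊` of imaginary units: all quaternions with square `-1`. -/
def imaginaryUnits : Set ℍ[ℝ] := {i | i ^ 2 = -1}

/-- The complex plane `ℂ_i = {u + i v : u, v ∈ ℝ}` attached to `i ∈ 𝕊`. -/
def slicePlane (i : ℍ[ℝ]) : Set ℍ[ℝ] := {q | ∃ u v : ℝ, q = (u : ℍ[ℝ]) + i * (v : ℍ[ℝ])}

/-- A quaternionic polynomial `P(q) = ∑ a_ℓ q ^ ℓ` is intrinsic if it maps every plane `ℂ_i`,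
`i ∈ 𝕊`, into itself. (`P.eval q` is `∑ a_ℓ q ^ ℓ`, with the coefficients on the left; such a
polynomial function is automatically slice hyperholomorphic.) -/
def IsIntrinsicPolynomial (P : ℍ[ℝ][X]) : Prop :=
  ∀ i ∈ imaginaryUnits, ∀ q ∈ slicePlane i, P.eval q ∈ slicePlane i

/-! ### Unbounded operators

`V →ₗ.[R] V` is the type of single valued `R`-linear operators whose domain is an `R`-submodule
of `V`. Sums and scalar multiples are Mathlib's: the domain of a sum is the intersection of the
domains, and a scalar multiple (also by `0`) keeps the domain. -/

namespace UnboundedOp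

section

variable {R V : Type*} [Ring R] [AddCommGroup V] [Module R V]

/-- The product `B A` with its maximal domain `{v ∈ D(A) : A v ∈ D(B)}`. -/
noncomputable def prod (B A : V →ₗ.[R] V) : V →ₗ.[R] V :=
  B.comp (A.domRestrict ((B.domain.comap A.toFun).map A.domain.subtype)) (by
    rintro ⟨x, hx⟩
    obtain ⟨⟨y, hy, hyx⟩, hxA⟩ := hx
    obtain rfl : (y : V) = x := hyx
    exact hy)

theorem mem_prod_domain {B A : V →ₗ.[R] V} {v : V} :
    v ∈ (prod B A).domain ↔ ∃ h : v ∈ A.domain, A ⟨v, h⟩ ∈ B.domain := by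
  constructor
  · rintro ⟨⟨y, hy, hyx⟩, hA⟩
    obtain rfl : (y : V) = v := hyx
    exact ⟨hA, hy⟩
  · rintro ⟨h, hB⟩
    exact ⟨⟨⟨v, h⟩, hB, rfl⟩, h⟩

theorem prod_apply {B A : V →ₗ.[R] V} {v : V} (h : v ∈ A.domain) (hB : A ⟨v, h⟩ ∈ B.domain)
    (h' : v ∈ (prod B A).domain) : prod B A ⟨v, h'⟩ = B ⟨A ⟨v, h⟩, hB⟩ := rfl

/-- The identity, with domain `V`. -/
def one (R V : Type*) [Ring R] [AddCommGroup V] [Module R V] : V →ₗ.[R] V :=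
  ⟨⊤, Submodule.subtype ⊤⟩

/-- The powers `T ^ 0 = I`, `T ^ (n + 1) = T T ^ n` on
`D(T ^ (n + 1)) = {v ∈ D(T ^ n) : T ^ n v ∈ D(T)}`. -/
noncomputable def pow (T : V →ₗ.[R] V) : ℕ → (V →ₗ.[R] V)
  | 0 => one R V
  | n + 1 => prod T (pow T n)

/-- The operator `∑_{ℓ ≤ n} a_ℓ T ^ ℓ`; its domain is `D(T ^ n)`. The scalars `a_ℓ` come from a
ring (or monoid) acting on `V` and commuting with the scalars for which `T` is linear. -/
noncomputable def polySum {S : Type*} [Monoid S] [DistribMulAction S V] [SMulCommClass R S V]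
    (n : ℕ) (a : ℕ → S) (T : V →ₗ.[R] V) : V →ₗ.[R] V :=
  ∑ l ∈ Finset.range (n + 1), a l • pow T l

theorem pow_succ_domain_le (T : V →ₗ.[R] V) (n : ℕ) :
    (pow T (n + 1)).domain ≤ (pow T n).domain := fun _ hv => (mem_prod_domain.1 hv).1

theorem polySum_domain {S : Type*} [Monoid S] [DistribMulAction S V] [SMulCommClass R S V]
    (n : ℕ) (a : ℕ → S) (T : V →ₗ.[R] V) : (polySum n a T).domain = (pow T n).domain := by
  induction n with
  | zero => simp [polySum]
  | succ n ih =>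
    rw [polySum, Finset.sum_range_succ, LinearPMap.add_domain]
    change (polySum n a T).domain ⊓ (pow T (n + 1)).domain = _
    rw [ih]
    exact inf_eq_right.2 (pow_succ_domain_le T n)

/-- An operator is injective on its domain. -/
def Injective (T : V →ₗ.[R] V) : Prop := Function.Injective fun v : T.domain => T v

/-- An operator is closed if its graph is closed in `V × V`. -/
def IsClosedOp [TopologicalSpace V] (T : V →ₗ.[R] V) : Prop := IsClosed (T.graph : Set (V × V))

end

section

variable {R V : Type*} [Ring R] [NormedAddCommGroup V] [NormedSpace ℝ V] [Module R V]
  [SMulCommClass R ℝ V]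

/-- The operator `T ^ 2 - 2 Re(s) T + |s| ^ 2 I : D(T ^ 2) → V`. -/
noncomputable def quadratic (T : V →ₗ.[R] V) (s : ℍ[ℝ]) : V →ₗ.[R] V :=
  pow T 2 - (2 * s.re) • T + (‖s‖ ^ 2) • one R V

/-- The `S`-resolvent set: those `s` for which `T ^ 2 - 2 Re(s) T + |s| ^ 2 I : D(T ^ 2) → V` is
bijective and its inverse is a bounded (`R`-linear) operator on `V`. -/
def sResolventSet (T : V →ₗ.[R] V) : Set ℍ[ℝ] :=
  {s | Function.Bijective (fun v : (quadratic T s).domain => quadratic T s v) ∧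
    ∃ B : V →L[R] V, ∀ v : (quadratic T s).domain, B (quadratic T s v) = v}

/-- The `S`-spectrum. -/
def sSpectrum (T : V →ₗ.[R] V) : Set ℍ[ℝ] := (sResolventSet T)ᶜ

end

section

variable {V : Type*} [AddCommGroup V] [Module ℍ[ℝ] V] [Module ℍ[ℝ]ᵐᵒᵖ V]

/-- `P(T) = ∑ a_ℓ T ^ ℓ` on `D(T ^ deg P)` for a right linear operator `T`. Right multiplication
of vectors by quaternions is the action of `ℍᵐᵒᵖ`; the coefficients multiply vectors from the
left, so that `P(T)` is again right linear. The zero polynomial gives the zero operator on `V`. -/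
noncomputable def evalRight [SMulCommClass ℍ[ℝ]ᵐᵒᵖ ℍ[ℝ] V] (P : ℍ[ℝ][X])
    (T : V →ₗ.[ℍ[ℝ]ᵐᵒᵖ] V) : V →ₗ.[ℍ[ℝ]ᵐᵒᵖ] V :=
  polySum P.natDegree P.coeff T

/-- `P(T)` on `D(T ^ deg P)` for a left linear operator `T`: here the coefficients multiply
vectors from the right, `P(T) v = ∑ (T ^ ℓ v) a_ℓ`, so that `P(T)` is again left linear. (The
coefficients of an intrinsic polynomial are real and the side does not matter.) -/
noncomputable def evalLeft [SMulCommClass ℍ[ℝ] ℍ[ℝ]ᵐᵒᵖ V] (P : ℍ[ℝ][X])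
    (T : V →ₗ.[ℍ[ℝ]] V) : V →ₗ.[ℍ[ℝ]] V :=
  polySum P.natDegree (fun l => MulOpposite.op (P.coeff l)) T

end

end UnboundedOp

/-!
Extend `T` to an everywhere defined real linear map `L` of `V`. On `D(T ^ n)` the polynomials of
degree at most `n` in `T` agree with those in `L`, so identities between values hold in the
commutative algebra `ℝ[L]`, and only domains need an argument: if `v ∈ D(T ^ deg q)` and
`q(T) v ∈ D(T ^ n)` then `v ∈ D(T ^ (deg q + n))`, by induction on `n`: all terms of `q(T) v`
but the leading one are already known to lie in `D(T ^ n)`. An intrinsic polynomial is real, and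
its coefficients may as well act from either side.

If `g(T)` has a bounded inverse `B` and `deg p ≤ deg g`, then `p(T) B` is bounded by the closed
graph theorem, and `w = p(T) v` if and only if `p(T) B v = B w`; hence `p(T)` is closed. A point
of `ρ_S(T)` provides such `g` of every even degree.

For `χ_z = (X - z)(X - conj z)`, the point `s` of a slice corresponding to `z ∈ ℂ` lies in `ρ_S(A)`
if and only if `χ_z(A)` is bijective, `A` being closed. Pairing the linear factors of `p - z` with
their conjugates gives `χ_z ∘ p = |c|² ∏ χ_w` over the complex solutions `w` of `p(w) = z`, and a
product of commuting operators is bijective if and only if every factor is.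
-/

section IntrinsicPolynomial

open Polynomial

theorem coeff_mem_of_eval_algebraMap_mem {k A : Type*} [Field k] [Infinite k] [Ring A]
    [Algebra k A] {W : Submodule k A} {P : A[X]} (hW : ∀ x : k, P.eval (algebraMap k A x) ∈ W)
    (l : ℕ) : P.coeff l ∈ W := by
  by_contra hl
  obtain ⟨f, hfl, hfW⟩ := Submodule.exists_le_ker_of_notMem hl
  let q : k[X] := ∑ i ∈ P.support, monomial i (f (P.coeff i))
  have hq (x : k) : q.eval x = f (P.eval (algebraMap k A x)) := by
    rw [eval_eq_sum (p := P), sum_def, eval_finsetSum, map_sum]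
    refine Finset.sum_congr rfl fun i _ => ?_
    rw [eval_monomial, ← map_pow, ← Algebra.commutes, ← Algebra.smul_def, map_smul, smul_eq_mul,
      mul_comm]
  have hq0 : q = 0 := Polynomial.funext fun x => by rw [hq, eval_zero]; exact hfW (hW x)
  have hcoeff : q.coeff l = f (P.coeff l) := by
    simp +contextual [q, finsetSum_coeff, coeff_monomial]
  exact hfl (by rw [← hcoeff, hq0, coeff_zero])

theorem mem_range_algebraMap_of_forall_mem_slicePlane {q : ℍ[ℝ]}
    (hq : ∀ i ∈ imaginaryUnits, q ∈ slicePlane i) : q ∈ Set.range (algebraMap ℝ ℍ[ℝ]) := by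
  have hunit (b c : ℝ) (hbc : b ^ 2 + c ^ 2 = 1) :
      ∃ i ∈ imaginaryUnits, i.imI = b ∧ i.imJ = c ∧ i.imK = 0 := by
    obtain ⟨i, hre, hI, hJ, hK⟩ : ∃ i : ℍ[ℝ], i.re = 0 ∧ i.imI = b ∧ i.imJ = c ∧ i.imK = 0 :=
      ⟨⟨0, b, c, 0⟩, rfl, rfl, rfl, rfl⟩
    refine ⟨i, ?_, hI, hJ, hK⟩
    rw [imaginaryUnits, Set.mem_ofPred_eq, Quaternion.sq_eq_neg_normSq.2 hre,
      Quaternion.normSq_def', hre, hI, hJ, hK]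
    simp [hbc]
  obtain ⟨i, hi, -, hiJ, hiK⟩ := hunit 1 0 (by norm_num)
  obtain ⟨j, hj, hjI, -, -⟩ := hunit 0 1 (by norm_num)
  obtain ⟨u, v, hui⟩ := hq i hi
  obtain ⟨u', v', huj⟩ := hq j hj
  have hI : q.imI = 0 := by simp [huj, hjI]
  have hJ : q.imJ = 0 := by simp [hui, hiJ]
  have hK : q.imK = 0 := by simp [hui, hiK]
  exact ⟨q.re, by rw [Quaternion.algebraMap_def]; ext <;> simp [hI, hJ, hK]⟩

theorem IsIntrinsicPolynomial.exists_map_algebraMap_eq {P : ℍ[ℝ][X]}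
    (hP : IsIntrinsicPolynomial P) : ∃ p : ℝ[X], p.map (algebraMap ℝ ℍ[ℝ]) = P := by
  rw [← mem_lifts, lifts_iff_coeff_lifts]
  exact coeff_mem_of_eval_algebraMap_mem (W := (Algebra.linearMap ℝ ℍ[ℝ]).range)
    fun x => mem_range_algebraMap_of_forall_mem_slicePlane fun i hi => hP i hi _ ⟨x, 0, by simp⟩

end IntrinsicPolynomial

section ComplexSlice

variable (φ : ℂ →ₐ[ℝ] ℍ[ℝ]) (z : ℂ)

theorem star_algHom_complex : star (φ z) = φ (starRingEnd ℂ z) := by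
  have hI : φ Complex.I ^ 2 = -1 := by rw [← map_pow, Complex.I_sq, map_neg, map_one]
  have hnorm : Quaternion.normSq (φ Complex.I) = 1 := by
    have h := congrArg Quaternion.normSq hI
    rw [map_pow, Quaternion.normSq_neg, map_one] at h
    nlinarith [Quaternion.normSq_nonneg (a := φ Complex.I)]
  have hstar : star (φ Complex.I) = -φ Complex.I :=
    Quaternion.star_eq_neg.2 (Quaternion.sq_eq_neg_normSq.1 (by rw [hI, hnorm]; simp))
  have hφ (w : ℂ) : φ w = w.re • 1 + w.im • φ Complex.I := by
    rw [← map_one φ, ← map_smul, ← map_smul, ← map_add]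
    simp
  rw [hφ z, hφ (starRingEnd ℂ z)]
  simp [hstar]

theorem normSq_algHom_complex : Quaternion.normSq (φ z) = Complex.normSq z := by
  rw [← Quaternion.coe_inj, ← Quaternion.self_mul_star, star_algHom_complex, ← map_mul,
    Complex.mul_conj]
  exact φ.commutes _

theorem norm_algHom_complex : ‖φ z‖ = ‖z‖ := by
  rw [← sq_eq_sq₀ (norm_nonneg _) (norm_nonneg _), pow_two ‖φ z‖,
    ← Quaternion.normSq_eq_norm_mul_self, normSq_algHom_complex, Complex.normSq_eq_norm_sq]

theorem re_algHom_complex : (φ z).re = z.re := by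
  have h : φ z + star (φ z) = ((2 * z.re : ℝ) : ℍ[ℝ]) := by
    rw [star_algHom_complex, ← map_add, Complex.add_conj]
    exact φ.commutes _
  rw [Quaternion.self_add_star'] at h
  linarith [Quaternion.coe_inj.1 h]

theorem exists_algHom_complex_apply_eq (q : ℍ[ℝ]) :
    ∃ (φ : ℂ →ₐ[ℝ] ℍ[ℝ]) (z : ℂ), φ z = q := by
  rcases eq_or_ne q.im 0 with him | him
  · exact ⟨Quaternion.ofComplex, q.re, by
      nth_rw 2 [← Quaternion.re_add_im q]
      rw [him, add_zero]
      exact Quaternion.ofComplex.commutes q.re⟩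
  · have hnorm : ‖q.im‖ ≠ 0 := norm_ne_zero_iff.2 him
    have hunit : (‖q.im‖⁻¹ • q.im) * (‖q.im‖⁻¹ • q.im) = -1 := by
      rw [smul_mul_smul_comm, ← pow_two q.im, Quaternion.sq_eq_neg_normSq.2 (Quaternion.re_im q),
        Quaternion.normSq_eq_norm_mul_self, smul_neg, ← Quaternion.coe_smul, smul_eq_mul]
      field_simp
      simp
    refine ⟨Complex.lift ⟨_, hunit⟩, ⟨q.re, ‖q.im‖⟩, ?_⟩
    simp [Complex.liftAux_apply, smul_smul, hnorm]

end ComplexSlice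

namespace UnboundedOp

section Graph

variable {R V : Type*} [Ring R] [AddCommGroup V] [Module R V]

theorem mem_graph_prod {A B : V →ₗ.[R] V} {v w : V} :
    (v, w) ∈ (prod B A).graph ↔ ∃ u, (v, u) ∈ A.graph ∧ (u, w) ∈ B.graph := by
  constructor
  · intro h
    obtain ⟨hA, hB⟩ := mem_prod_domain.1 (LinearPMap.mem_domain_of_mem_graph h)
    have hw := (LinearPMap.image_iff (LinearPMap.mem_domain_of_mem_graph h)).2 h
    exact ⟨A ⟨v, hA⟩, A.mem_graph ⟨v, hA⟩, (LinearPMap.image_iff hB).1 hw⟩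
  · rintro ⟨u, hA, hB⟩
    obtain ⟨⟨v, hv⟩, rfl, rfl⟩ := A.mem_graph_iff.1 hA
    have hu := LinearPMap.mem_domain_of_mem_graph hB
    have hvu : v ∈ (prod B A).domain := mem_prod_domain.2 ⟨hv, hu⟩
    exact (LinearPMap.image_iff hvu).1 ((LinearPMap.image_iff hu).2 hB)

theorem mem_graph_inverse {A : V →ₗ.[R] V} (hA : Injective A) {v w : V} :
    (w, v) ∈ A.inverse.graph ↔ (v, w) ∈ A.graph := by
  rw [LinearPMap.inverse_graph (LinearMap.ker_eq_bot.2 hA), Submodule.mem_map]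
  constructor
  · rintro ⟨⟨v', w'⟩, h, heq⟩
    obtain ⟨rfl, rfl⟩ := Prod.mk.inj heq
    exact h
  · exact fun h => ⟨(v, w), h, rfl⟩

theorem exists_mem_graph_inverse_prod {A B : V →ₗ.[R] V} (hA : Injective A)
    (hAB : prod B A = prod A B) {v : V} (hv : v ∈ A.inverse.domain ⊓ B.domain) :
    ∃ u, (v, u) ∈ (prod A.inverse B).graph ∧ (v, u) ∈ (prod B A.inverse).graph := by
  obtain ⟨w, hvw⟩ := LinearPMap.mem_domain_iff.1 hv.1
  obtain ⟨y, hvy⟩ := LinearPMap.mem_domain_iff.1 hv.2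
  have hwy : (w, y) ∈ (prod B A).graph := mem_graph_prod.2 ⟨v, (mem_graph_inverse hA).1 hvw, hvy⟩
  obtain ⟨u, hwu, huy⟩ := mem_graph_prod.1 (hAB ▸ hwy)
  exact ⟨u, mem_graph_prod.2 ⟨y, hvy, (mem_graph_inverse hA).2 huy⟩,
    mem_graph_prod.2 ⟨w, hvw, hwu⟩⟩

theorem inverse_domain_inf_domain_le {A B : V →ₗ.[R] V} (hA : Injective A)
    (hAB : prod B A = prod A B) :
    A.inverse.domain ⊓ B.domain ≤ (prod A.inverse B).domain ⊓ (prod B A.inverse).domain :=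
  fun _ hv =>
    have ⟨_, h₁, h₂⟩ := exists_mem_graph_inverse_prod hA hAB hv
    ⟨LinearPMap.mem_domain_of_mem_graph h₁, LinearPMap.mem_domain_of_mem_graph h₂⟩

theorem inverse_prod_apply_eq {A B : V →ₗ.[R] V} (hA : Injective A) (hAB : prod B A = prod A B)
    {v : V} (hv : v ∈ A.inverse.domain ⊓ B.domain) (h₁ : v ∈ (prod A.inverse B).domain)
    (h₂ : v ∈ (prod B A.inverse).domain) :
    prod A.inverse B ⟨v, h₁⟩ = prod B A.inverse ⟨v, h₂⟩ := by
  obtain ⟨u, hu₁, hu₂⟩ := exists_mem_graph_inverse_prod hA hAB hv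
  rw [← (LinearPMap.image_iff h₁).2 hu₁, ← (LinearPMap.image_iff h₂).2 hu₂]

/-- An operator maps its domain bijectively onto the whole space. -/
def Bijective (A : V →ₗ.[R] V) : Prop := Function.Bijective fun v : A.domain => A v

theorem bijective_iff_existsUnique_mem_graph {A : V →ₗ.[R] V} :
    Bijective A ↔ ∀ w, ∃! v, (v, w) ∈ A.graph := by
  refine (Function.bijective_iff_existsUnique _).trans (forall_congr' fun w => ?_)
  constructor
  · rintro ⟨v, rfl, huniq⟩
    refine ⟨v, A.mem_graph v, fun v' hv' => ?_⟩
    have hd := LinearPMap.mem_domain_of_mem_graph hv'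
    exact congrArg Subtype.val (huniq ⟨v', hd⟩ ((LinearPMap.image_iff hd).2 hv').symm)
  · rintro ⟨v, hv, huniq⟩
    have hd := LinearPMap.mem_domain_of_mem_graph hv
    exact ⟨⟨v, hd⟩, ((LinearPMap.image_iff hd).2 hv).symm, fun v' hv' =>
      Subtype.ext (huniq v' (hv' ▸ A.mem_graph v'))⟩

theorem Bijective.mem_graph_iff {A : V →ₗ.[R] V} (hA : Bijective A) {B : V → V}
    (hB : ∀ v : A.domain, B (A v) = v) {v w : V} : (v, w) ∈ A.graph ↔ B w = v := by
  rw [LinearPMap.mem_graph_iff]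
  constructor
  · rintro ⟨v, rfl, rfl⟩
    exact hB v
  · rintro rfl
    obtain ⟨v, rfl⟩ := hA.surjective w
    exact ⟨v, (hB v).symm, rfl⟩

theorem Bijective.prod {A B : V →ₗ.[R] V} (hA : Bijective A) (hB : Bijective B) :
    Bijective (prod A B) := by
  rw [bijective_iff_existsUnique_mem_graph] at *
  intro w
  obtain ⟨u, hu, hu_unique⟩ := hA w
  obtain ⟨v, hv, hv_unique⟩ := hB u
  refine ⟨v, mem_graph_prod.2 ⟨u, hv, hu⟩, fun v' hv' => ?_⟩
  obtain ⟨u', hv'u', hu'w⟩ := mem_graph_prod.1 hv'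
  exact hv_unique v' (hu_unique u' hu'w ▸ hv'u')

theorem Bijective.of_prod_comm {A B : V →ₗ.[R] V} (h : Bijective (UnboundedOp.prod A B))
    (hAB : UnboundedOp.prod A B = UnboundedOp.prod B A) : Bijective A := by
  rw [bijective_iff_existsUnique_mem_graph] at *
  intro w
  obtain ⟨v, hv, -⟩ := h w
  obtain ⟨u, -, huw⟩ := mem_graph_prod.1 hv
  refine ⟨u, huw, fun u' hu'w => sub_eq_zero.1 ?_⟩
  have hker : (u' - u, 0) ∈ A.graph := by simpa using A.graph.sub_mem hu'w huw
  exact (h 0).unique (hAB ▸ mem_graph_prod.2 ⟨0, hker, B.graph.zero_mem⟩)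
    (UnboundedOp.prod A B).graph.zero_mem

end Graph

section Extension

variable (𝕜 : Type*) {R V : Type*} [Field 𝕜] [Ring R] [Algebra 𝕜 R] [AddCommGroup V]
  [Module 𝕜 V] [Module R V] [IsScalarTower 𝕜 R V]

/-- An everywhere defined `𝕜`-linear extension of `T`, chosen arbitrarily off `D(T)`. On
`D(T ^ n)` the powers and polynomials of `T` of degree at most `n` are those of the extension,
which lie in the algebra `Module.End 𝕜 V`. -/
noncomputable def linearExtension (T : V →ₗ.[R] V) : Module.End 𝕜 V :=
  (LinearMap.exists_extend (p := T.domain.restrictScalars 𝕜)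
    (T.toFun.restrictScalars 𝕜)).choose

theorem linearExtension_apply (T : V →ₗ.[R] V) (v : T.domain) : linearExtension 𝕜 T v = T v :=
  LinearMap.congr_fun (LinearMap.exists_extend (p := T.domain.restrictScalars 𝕜)
    (T.toFun.restrictScalars 𝕜)).choose_spec v

theorem mem_graph_iff_linearExtension {T : V →ₗ.[R] V} {v w : V} :
    (v, w) ∈ T.graph ↔ v ∈ T.domain ∧ linearExtension 𝕜 T v = w := by
  rw [LinearPMap.mem_graph_iff]
  constructor
  · rintro ⟨v, rfl, rfl⟩
    exact ⟨v.2, linearExtension_apply 𝕜 T v⟩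
  · rintro ⟨hv, rfl⟩
    exact ⟨⟨v, hv⟩, rfl, (linearExtension_apply 𝕜 T ⟨v, hv⟩).symm⟩

theorem pow_apply (T : V →ₗ.[R] V) (n : ℕ) {v : V} (hv : v ∈ (pow T n).domain) :
    pow T n ⟨v, hv⟩ = (linearExtension 𝕜 T ^ n) v := by
  induction n with
  | zero => rfl
  | succ n ih =>
    obtain ⟨hn, hT⟩ := mem_prod_domain.1 hv
    rw [pow_succ', Module.End.mul_apply, ← ih hn, linearExtension_apply 𝕜 T ⟨_, hT⟩]
    exact prod_apply hn hT hv

theorem mem_pow_succ_domain {T : V →ₗ.[R] V} {n : ℕ} {v : V} :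
    v ∈ (pow T (n + 1)).domain ↔
      v ∈ (pow T n).domain ∧ (linearExtension 𝕜 T ^ n) v ∈ T.domain := by
  simp only [pow, mem_prod_domain, pow_apply 𝕜, exists_prop]

theorem mem_pow_add_domain {T : V →ₗ.[R] V} {m n : ℕ} {v : V} :
    v ∈ (pow T (m + n)).domain ↔
      v ∈ (pow T m).domain ∧ (linearExtension 𝕜 T ^ m) v ∈ (pow T n).domain := by
  induction n with
  | zero => exact ⟨fun h => ⟨h, trivial⟩, And.left⟩
  | succ n ih =>
    rw [← add_assoc, mem_pow_succ_domain 𝕜, ih, mem_pow_succ_domain 𝕜, add_comm m n, pow_add,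
      Module.End.mul_apply, and_assoc]

end Extension

section Polynomial

open Polynomial

theorem pow_domain_antitone {R V : Type*} [Ring R] [AddCommGroup V] [Module R V]
    (T : V →ₗ.[R] V) : Antitone fun n => (pow T n).domain :=
  antitone_nat_of_succ_le (pow_succ_domain_le T)

variable {𝕜 R V : Type*} [Field 𝕜] [Ring R] [Algebra 𝕜 R] [AddCommGroup V]
  [Module 𝕜 V] [Module R V] [IsScalarTower 𝕜 R V]

theorem polySum_apply {S : Type*} [Monoid S] [DistribMulAction S V] [SMulCommClass R S V]
    (n : ℕ) (a : ℕ → S) (T : V →ₗ.[R] V) {v : V} (hv : v ∈ (polySum n a T).domain) :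
    polySum n a T ⟨v, hv⟩
      = ∑ l ∈ Finset.range (n + 1), a l • (linearExtension 𝕜 T ^ l) v := by
  have key (m : ℕ) (h : v ∈ (∑ l ∈ Finset.range m, a l • pow T l).domain) :
      (∑ l ∈ Finset.range m, a l • pow T l) ⟨v, h⟩
        = ∑ l ∈ Finset.range m, a l • (linearExtension 𝕜 T ^ l) v := by
    induction m with
    | zero => rfl
    | succ m ih =>
      revert h
      rw [Finset.sum_range_succ, Finset.sum_range_succ]
      intro h
      rw [LinearPMap.add_domain] at h
      rw [← ih h.1, ← pow_apply 𝕜 T m h.2]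
      rfl
  exact key (n + 1) hv

/-- The operator `p(T)` on `D(T ^ deg p)` for a polynomial `p` with coefficients in a central
field. -/
noncomputable def polyEval (p : 𝕜[X]) (T : V →ₗ.[R] V) : V →ₗ.[R] V :=
  polySum p.natDegree p.coeff T

theorem polyEval_domain (p : 𝕜[X]) (T : V →ₗ.[R] V) :
    (polyEval p T).domain = (pow T p.natDegree).domain := polySum_domain _ _ _

theorem polyEval_apply (p : 𝕜[X]) (T : V →ₗ.[R] V) {v : V} (hv : v ∈ (polyEval p T).domain) :
    polyEval p T ⟨v, hv⟩ = aeval (linearExtension 𝕜 T) p v := by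
  rw [aeval_eq_sum_range, LinearMap.sum_apply]
  exact polySum_apply (𝕜 := 𝕜) _ _ _ hv

theorem mem_graph_polyEval {p : 𝕜[X]} {T : V →ₗ.[R] V} {v w : V} :
    (v, w) ∈ (polyEval p T).graph ↔
      v ∈ (pow T p.natDegree).domain ∧ aeval (linearExtension 𝕜 T) p v = w := by
  rw [← polyEval_domain, LinearPMap.mem_graph_iff]
  constructor
  · rintro ⟨v, rfl, rfl⟩
    exact ⟨v.2, (polyEval_apply p T v.2).symm⟩
  · rintro ⟨hv, rfl⟩
    exact ⟨⟨v, hv⟩, rfl, polyEval_apply p T hv⟩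

theorem eq_polyEval {p : 𝕜[X]} {T A : V →ₗ.[R] V}
    (hdom : ∀ v, v ∈ A.domain ↔ v ∈ (pow T p.natDegree).domain)
    (happly : ∀ v (hv : v ∈ A.domain), A ⟨v, hv⟩ = aeval (linearExtension 𝕜 T) p v) :
    A = polyEval p T :=
  LinearPMap.ext (SetLike.ext fun v => by rw [hdom, polyEval_domain]) fun v hv hv' => by
    rw [happly, polyEval_apply]

theorem aeval_mem_pow_domain (q : 𝕜[X]) {T : V →ₗ.[R] V} {n : ℕ} {v : V}
    (hv : v ∈ (pow T (q.natDegree + n)).domain) :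
    aeval (linearExtension 𝕜 T) q v ∈ (pow T n).domain := by
  rw [aeval_eq_sum_range, LinearMap.sum_apply]
  refine Submodule.sum_mem _ fun l hl => Submodule.smul_of_tower_mem _ _ ?_
  have hln : l + n ≤ q.natDegree + n := by grind
  exact ((mem_pow_add_domain 𝕜).1 (pow_domain_antitone T hln hv)).2

theorem mem_pow_domain_of_aeval_mem {q : 𝕜[X]} (hq : q ≠ 0) {T : V →ₗ.[R] V} {n : ℕ} {v : V}
    (hv : v ∈ (pow T q.natDegree).domain)
    (hqv : aeval (linearExtension 𝕜 T) q v ∈ (pow T n).domain) :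
    v ∈ (pow T (q.natDegree + n)).domain := by
  induction n with
  | zero => exact hv
  | succ n ih =>
    have hvn := ih (pow_domain_antitone T n.le_succ hqv)
    rw [aeval_eq_sum_range, Finset.sum_range_succ, LinearMap.add_apply, LinearMap.sum_apply] at hqv
    have hlow : ∑ l ∈ Finset.range q.natDegree, (q.coeff l • linearExtension 𝕜 T ^ l) v ∈
        (pow T (n + 1)).domain := by
      refine Submodule.sum_mem _ fun l hl => Submodule.smul_of_tower_mem _ _ ?_
      have hl' : l + (n + 1) ≤ q.natDegree + n := by grind
      exact ((mem_pow_add_domain 𝕜).1 (pow_domain_antitone T hl' hvn)).2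
    have hlead := Submodule.smul_of_tower_mem _ q.leadingCoeff⁻¹
      ((Submodule.add_mem_iff_right _ hlow).1 hqv)
    rw [LinearMap.smul_apply, coeff_natDegree,
      inv_smul_smul₀ (leadingCoeff_ne_zero.2 hq)] at hlead
    exact (mem_pow_add_domain 𝕜).2 ⟨hv, hlead⟩

theorem aeval_mem_pow_domain_iff {q : 𝕜[X]} (hq : q ≠ 0) {T : V →ₗ.[R] V} {n : ℕ} {v : V} :
    (v ∈ (pow T q.natDegree).domain ∧ aeval (linearExtension 𝕜 T) q v ∈ (pow T n).domain) ↔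
      v ∈ (pow T (q.natDegree + n)).domain :=
  ⟨fun h => mem_pow_domain_of_aeval_mem hq h.1 h.2,
    fun h => ⟨pow_domain_antitone T (Nat.le_add_right _ _) h, aeval_mem_pow_domain q h⟩⟩

theorem prod_polyEval {p q : 𝕜[X]} (h : p ≠ 0 ∨ q.natDegree = 0) (T : V →ₗ.[R] V) :
    prod (polyEval p T) (polyEval q T) = polyEval (p * q) T := by
  have hdom (v : V) : (v ∈ (pow T q.natDegree).domain ∧
      aeval (linearExtension 𝕜 T) q v ∈ (pow T p.natDegree).domain) ↔
      v ∈ (pow T (p * q).natDegree).domain := by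
    rcases eq_or_ne q 0 with rfl | hq
    · simp
    rcases eq_or_ne p 0 with rfl | hp
    · simp [h.resolve_left (by simp), pow, one]
    · rw [aeval_mem_pow_domain_iff hq, natDegree_mul hp hq, add_comm]
  refine LinearPMap.eq_of_eq_graph (SetLike.ext fun ⟨v, w⟩ => ?_)
  rw [mem_graph_prod, mem_graph_polyEval, ← hdom, map_mul, Module.End.mul_apply]
  simp only [mem_graph_polyEval]
  grind

theorem polyEval_one (T : V →ₗ.[R] V) : polyEval (1 : 𝕜[X]) T = one R V :=
  (eq_polyEval (fun v => by simp [pow]) fun v hv => by simp; rfl).symm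

theorem polyEval_X (T : V →ₗ.[R] V) : polyEval (X : 𝕜[X]) T = T := by
  refine (eq_polyEval (fun v => ?_) fun v hv => ?_).symm
  · rw [natDegree_X, ← zero_add 1, mem_pow_succ_domain 𝕜]
    exact (and_iff_right trivial).symm
  · rw [aeval_X, linearExtension_apply 𝕜 T ⟨v, hv⟩]

theorem pow_polyEval (p : 𝕜[X]) (T : V →ₗ.[R] V) (n : ℕ) :
    pow (polyEval p T) n = polyEval (p ^ n) T := by
  induction n with
  | zero => rw [pow_zero, polyEval_one, pow]
  | succ n ih =>
    rw [pow, ih, pow_succ', prod_polyEval]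
    rcases eq_or_ne p 0 with rfl | hp
    · exact .inr (by simp)
    · exact .inl hp

theorem polyEval_polyEval (f p : 𝕜[X]) (T : V →ₗ.[R] V) :
    polyEval f (polyEval p T) = polyEval (f.comp p) T := by
  refine eq_polyEval (fun v => ?_) fun v hv => ?_
  · rw [polyEval_domain, pow_polyEval, polyEval_domain, natDegree_pow, natDegree_comp]
  · rw [polyEval_domain] at hv
    rw [polyEval_apply, aeval_comp, aeval_eq_sum_range, aeval_eq_sum_range, LinearMap.sum_apply,
      LinearMap.sum_apply]
    refine Finset.sum_congr rfl fun k hk => ?_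
    have hvk := pow_domain_antitone (polyEval p T) (Finset.mem_range_succ_iff.1 hk) hv
    rw [LinearMap.smul_apply, LinearMap.smul_apply, ← pow_apply 𝕜 _ _ hvk, ← map_pow]
    have hgraph {w : V} (hw : (v, w) ∈ (pow (polyEval p T) k).graph) :
        aeval (linearExtension 𝕜 T) (p ^ k) v = w := by
      rw [pow_polyEval, mem_graph_polyEval] at hw
      exact hw.2
    rw [hgraph ((pow (polyEval p T) k).mem_graph ⟨v, hvk⟩)]

theorem subsingleton_of_injective_polyEval_zero {T : V →ₗ.[R] V}
    (h : Injective (polyEval (0 : 𝕜[X]) T)) : Subsingleton V := by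
  have hmem (v : V) : v ∈ (polyEval (0 : 𝕜[X]) T).domain := by simp [polyEval_domain, pow, one]
  refine ⟨fun v w => congrArg Subtype.val (@h ⟨v, hmem v⟩ ⟨w, hmem w⟩ ?_)⟩
  simp [polyEval_apply]

theorem prod_polyEval_comm_of_injective {p q : 𝕜[X]} (hq : q ≠ 0) {T : V →ₗ.[R] V}
    (hp : Injective (polyEval p T)) :
    prod (polyEval q T) (polyEval p T) = prod (polyEval p T) (polyEval q T) := by
  rcases eq_or_ne p 0 with rfl | hp0
  · have := subsingleton_of_injective_polyEval_zero hp
    have hall (A B : V →ₗ.[R] V) : A = B :=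
      LinearPMap.ext (Subsingleton.elim _ _) fun _ _ _ => Subsingleton.elim _ _
    exact hall _ _
  · rw [prod_polyEval (.inl hq), prod_polyEval (.inl hp0), mul_comm]

theorem bijective_polyEval_C {a : 𝕜} (ha : a ≠ 0) (T : V →ₗ.[R] V) :
    Bijective (polyEval (C a) T) := by
  refine bijective_iff_existsUnique_mem_graph.2 fun w => ?_
  simp only [mem_graph_polyEval, natDegree_C, aeval_C, Module.algebraMap_end_apply]
  refine ⟨a⁻¹ • w, ⟨trivial, smul_inv_smul₀ ha w⟩, fun v hv => ?_⟩
  rw [← hv.2, inv_smul_smul₀ ha]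

theorem bijective_polyEval_mul {p q : 𝕜[X]} (hp : p ≠ 0) (hq : q ≠ 0) {T : V →ₗ.[R] V} :
    Bijective (polyEval (p * q) T) ↔ Bijective (polyEval p T) ∧ Bijective (polyEval q T) := by
  have hpq := prod_polyEval (.inl hp) T (q := q)
  have hqp := prod_polyEval (.inl hq) T (q := p)
  rw [mul_comm] at hqp
  refine ⟨fun h => ⟨.of_prod_comm (hpq.symm ▸ h) (hpq.trans hqp.symm),
    .of_prod_comm (hqp.symm ▸ h) (hqp.trans hpq.symm)⟩, fun h => hpq ▸ h.1.prod h.2⟩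

theorem bijective_polyEval_multiset_prod {s : Multiset 𝕜[X]} (hs : 0 ∉ s) {T : V →ₗ.[R] V} :
    Bijective (polyEval s.prod T) ↔ ∀ p ∈ s, Bijective (polyEval p T) := by
  induction s using Multiset.induction with
  | empty => simpa using bijective_polyEval_C (one_ne_zero (α := 𝕜)) T
  | cons p s ih =>
    rw [Multiset.mem_cons, not_or] at hs
    rw [Multiset.prod_cons, bijective_polyEval_mul (Ne.symm hs.1) (Multiset.prod_ne_zero hs.2),
      ih hs.2, Multiset.forall_mem_cons]

end Polynomial

section BoundedlyInvertible

variable {R V : Type*} [Ring R] [AddCommGroup V] [Module R V] [TopologicalSpace V]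

/-- `A` is a bijection of its domain onto `V` with bounded inverse `B : V → V`. This is stated for
the graph of `A`, so that no domain membership proofs are carried around. -/
def BoundedlyInvertible (A : V →ₗ.[R] V) : Prop :=
  ∃ B : V →L[R] V, ∀ v w, (v, w) ∈ A.graph ↔ B w = v

theorem BoundedlyInvertible.bijective {A : V →ₗ.[R] V} (hA : BoundedlyInvertible A) :
    Bijective A := by
  obtain ⟨B, hB⟩ := hA
  simp only [bijective_iff_existsUnique_mem_graph, hB, existsUnique_eq', implies_true]

theorem BoundedlyInvertible.prod {A₁ A₂ : V →ₗ.[R] V} (h₁ : BoundedlyInvertible A₁)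
    (h₂ : BoundedlyInvertible A₂) : BoundedlyInvertible (prod A₁ A₂) := by
  obtain ⟨B₁, hB₁⟩ := h₁
  obtain ⟨B₂, hB₂⟩ := h₂
  exact ⟨B₂ ∘L B₁, fun v w => by
    simp only [mem_graph_prod, hB₁, hB₂, exists_eq_right', ContinuousLinearMap.comp_apply]⟩

theorem BoundedlyInvertible.pow {A : V →ₗ.[R] V} (hA : BoundedlyInvertible A) (n : ℕ) :
    BoundedlyInvertible (pow A n) := by
  induction n with
  | zero => exact ⟨.id R V, fun v w => by simp [UnboundedOp.pow, one, eq_comm]⟩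
  | succ n ih => exact hA.prod ih

theorem boundedlyInvertible_iff {A : V →ₗ.[R] V} :
    BoundedlyInvertible A ↔ Bijective A ∧ ∃ B : V →L[R] V, ∀ v : A.domain, B (A v) = v := by
  refine ⟨fun hA => ⟨hA.bijective, ?_⟩, fun ⟨hA, B, hB⟩ => ⟨B, fun v w => hA.mem_graph_iff hB⟩⟩
  obtain ⟨B, hB⟩ := hA
  exact ⟨B, fun v => (hB _ _).1 (A.mem_graph v)⟩

end BoundedlyInvertible

section Closed

open Polynomial

theorem IsClosedOp.boundedlyInvertible (𝕜 : Type*) {R V : Type*} [NontriviallyNormedField 𝕜]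
    [Ring R] [Algebra 𝕜 R] [NormedAddCommGroup V] [NormedSpace 𝕜 V] [CompleteSpace V] [Module R V]
    [IsScalarTower 𝕜 R V] {T : V →ₗ.[R] V} (hT : IsClosedOp T) (hbij : Bijective T) :
    BoundedlyInvertible T := by
  let e : T.domain ≃ₗ[R] V := LinearEquiv.ofBijective T.toFun hbij
  let B : V →ₗ[R] V := T.domain.subtype ∘ₗ e.symm
  have hB (v : T.domain) : B (T v) = v := congrArg Subtype.val (e.symm_apply_apply v)
  have hcont : Continuous (B.restrictScalars 𝕜) := by
    refine LinearMap.continuous_of_isClosed_graph _ ?_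
    convert hT.preimage continuous_swap using 1
    ext ⟨w, v⟩
    exact eq_comm.trans (hbij.mem_graph_iff hB).symm
  exact boundedlyInvertible_iff.2 ⟨hbij, ⟨B, hcont⟩, hB⟩

variable {𝕜 R V : Type*} [NontriviallyNormedField 𝕜] [Ring R] [Algebra 𝕜 R]
  [NormedAddCommGroup V] [NormedSpace 𝕜 V] [CompleteSpace V] [Module R V] [IsScalarTower 𝕜 R V]
  {T : V →ₗ.[R] V}

variable {E : Type*} [NormedAddCommGroup E] [NormedSpace 𝕜 E] [CompleteSpace E] {F : E →ₗ[𝕜] V}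

theorem IsClosedOp.continuous_linearExtension_comp (hT : IsClosedOp T) (hF : Continuous F)
    (hdom : ∀ x, F x ∈ T.domain) : Continuous (linearExtension 𝕜 T ∘ₗ F) := by
  refine LinearMap.continuous_of_isClosed_graph _ ?_
  convert hT.preimage (hF.prodMap continuous_id) using 1
  ext ⟨x, y⟩
  simp [mem_graph_iff_linearExtension 𝕜, hdom, eq_comm]

theorem IsClosedOp.continuous_linearExtension_pow_comp (hT : IsClosedOp T) (hF : Continuous F)
    {n : ℕ} (hdom : ∀ x, F x ∈ (pow T n).domain) :
    Continuous ((linearExtension 𝕜 T ^ n) ∘ₗ F) := by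
  induction n with
  | zero => exact hF
  | succ n ih =>
    simp only [mem_pow_succ_domain 𝕜, forall_and] at hdom
    rw [pow_succ']
    exact hT.continuous_linearExtension_comp (ih hdom.1) hdom.2

theorem IsClosedOp.continuous_aeval_linearExtension_comp (hT : IsClosedOp T) (hF : Continuous F)
    {p : 𝕜[X]} (hdom : ∀ x, F x ∈ (pow T p.natDegree).domain) :
    Continuous (aeval (linearExtension 𝕜 T) p ∘ₗ F) := by
  simp only [aeval_eq_sum_range, LinearMap.coe_comp, LinearMap.coe_sum, LinearMap.coe_smul,
    Function.comp_def, Finset.sum_apply, Pi.smul_apply]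
  refine continuous_finsetSum _ fun l hl => Continuous.const_smul ?_ _
  exact hT.continuous_linearExtension_pow_comp hF fun x =>
    pow_domain_antitone T (Finset.mem_range_succ_iff.1 hl) (hdom x)

-- With `B = g(T)⁻¹`, the graph of `p(T)` is the equalizer of the bounded maps
-- `(v, w) ↦ p(T) B v` and `(v, w) ↦ B w`.
theorem IsClosedOp.polyEval_of_natDegree_le (hT : IsClosedOp T) {g p : 𝕜[X]} (hg : g ≠ 0)
    (hinv : BoundedlyInvertible (polyEval g T)) (hdeg : p.natDegree ≤ g.natDegree) :
    IsClosedOp (polyEval p T) := by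
  obtain ⟨B, hB⟩ := hinv
  set L := linearExtension 𝕜 T with hL
  have hBdom (v : V) : B v ∈ (pow T g.natDegree).domain :=
    (mem_graph_polyEval.1 ((hB _ v).2 rfl)).1
  have hBp (v : V) : B v ∈ (pow T p.natDegree).domain := pow_domain_antitone T hdeg (hBdom v)
  have hgB (v : V) : aeval L g (B v) = v := (mem_graph_polyEval.1 ((hB _ v).2 rfl)).2
  have hcomm (u : V) : aeval L g (aeval L p u) = aeval L p (aeval L g u) :=
    LinearMap.congr_fun (Commute.all g p |>.map (aeval L)).eq u
  have hgraph (v w : V) : (v, w) ∈ (polyEval p T).graph ↔ aeval L p (B v) = B w := by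
    rw [mem_graph_polyEval, ← hL, eq_comm (b := B w), ← hB, mem_graph_polyEval, ← hL, hcomm, hgB]
    refine and_congr_left fun _ => ⟨fun hv => ?_, fun h => ?_⟩
    · refine aeval_mem_pow_domain p ?_
      rw [add_comm]
      exact mem_pow_domain_of_aeval_mem hg (hBdom v) ((hgB v).symm ▸ hv)
    · rcases eq_or_ne p 0 with rfl | hp
      · simp [pow, one]
      have hBv := mem_pow_domain_of_aeval_mem hp (hBp v) h
      rw [add_comm] at hBv
      exact hgB v ▸ aeval_mem_pow_domain g hBv
  have hpB : Continuous (aeval L p ∘ₗ B.toLinearMap.restrictScalars 𝕜) :=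
    hT.continuous_aeval_linearExtension_comp B.continuous hBp
  rw [IsClosedOp]
  convert isClosed_eq (hpB.comp continuous_fst) (B.continuous.comp continuous_snd) using 1
  ext ⟨v, w⟩
  exact hgraph v w

theorem IsClosedOp.polyEval_of_boundedlyInvertible (hT : IsClosedOp T) {g : 𝕜[X]}
    (hg : g.natDegree ≠ 0) (hinv : BoundedlyInvertible (polyEval g T)) (p : 𝕜[X]) :
    IsClosedOp (polyEval p T) := by
  have hg0 : g ≠ 0 := ne_zero_of_natDegree_gt (Nat.pos_of_ne_zero hg)
  refine hT.polyEval_of_natDegree_le (pow_ne_zero p.natDegree hg0)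
    (pow_polyEval g T _ ▸ hinv.pow p.natDegree) ?_
  rw [natDegree_pow]
  exact Nat.le_mul_of_pos_right _ (Nat.pos_of_ne_zero hg)

end Closed

section CharQuadratic

open Polynomial

/-- The real polynomial `(X - z) (X - conj z)`. For `s = φ z` with `φ : ℂ →ₐ[ℝ] ℍ[ℝ]` it is the
characteristic polynomial `X ^ 2 - 2 Re(s) X + |s| ^ 2` of the quaternion `s`. -/
noncomputable def charQuadratic (z : ℂ) : ℝ[X] := X ^ 2 - C (2 * z.re) * X + C (‖z‖ ^ 2)

theorem natDegree_charQuadratic (z : ℂ) : (charQuadratic z).natDegree = 2 := by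
  rw [charQuadratic]
  compute_degree!

theorem charQuadratic_ne_zero (z : ℂ) : charQuadratic z ≠ 0 :=
  ne_zero_of_natDegree_gt (n := 0) (by rw [natDegree_charQuadratic]; exact two_pos)

theorem map_charQuadratic (z : ℂ) :
    (charQuadratic z).map (algebraMap ℝ ℂ) = (X - C z) * (X - C (starRingEnd ℂ z)) := by
  have hsum : C ((2 * z.re : ℝ) : ℂ) = C z + C (starRingEnd ℂ z) := by
    rw [← map_add, Complex.add_conj]
  have hprod : C ((‖z‖ ^ 2 : ℝ) : ℂ) = C z * C (starRingEnd ℂ z) := by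
    rw [← map_mul, Complex.mul_conj']
    norm_cast
  simp only [charQuadratic, Polynomial.map_add, Polynomial.map_sub, Polynomial.map_mul,
    Polynomial.map_pow, map_X, map_C, Complex.coe_algebraMap, hsum, hprod]
  ring

theorem mul_map_conj_eq_map (f : ℂ[X]) :
    f * f.map (starRingEnd ℂ) =
      (C (‖f.leadingCoeff‖ ^ 2) * (f.roots.map charQuadratic).prod).map (algebraMap ℝ ℂ) := by
  have hf : f = C f.leadingCoeff * (f.roots.map (X - C ·)).prod :=
    (IsAlgClosed.splits f).eq_prod_roots
  have hconj : f.map (starRingEnd ℂ) = C (starRingEnd ℂ f.leadingCoeff) *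
      (f.roots.map fun w => X - C (starRingEnd ℂ w)).prod := by
    conv_lhs => rw [hf]
    simp [Polynomial.map_multiset_prod]
  have hlead : C ((‖f.leadingCoeff‖ ^ 2 : ℝ) : ℂ) =
      C f.leadingCoeff * C (starRingEnd ℂ f.leadingCoeff) := by
    rw [← map_mul, Complex.mul_conj']
    norm_cast
  rw [hconj, Polynomial.map_mul, map_C, Complex.coe_algebraMap, hlead,
    Polynomial.map_multiset_prod, Multiset.map_map]
  simp only [Function.comp_def, map_charQuadratic, Multiset.prod_map_mul]
  nth_rw 1 [hf]
  ring

theorem charQuadratic_comp (z : ℂ) (p : ℝ[X]) :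
    (charQuadratic z).comp p = C (‖(p.map (algebraMap ℝ ℂ) - C z).leadingCoeff‖ ^ 2) *
      ((p.map (algebraMap ℝ ℂ) - C z).roots.map charQuadratic).prod := by
  refine map_injective _ (algebraMap ℝ ℂ).injective ?_
  rw [← mul_map_conj_eq_map, Polynomial.map_comp, map_charQuadratic, mul_comp, sub_comp, sub_comp,
    X_comp, C_comp, C_comp, Polynomial.map_sub, map_map, map_C]
  congr 4
  ext x
  simp

end CharQuadratic

section SSpectrum

open Polynomial

variable {R V : Type*} [Ring R] [Algebra ℝ R] [NormedAddCommGroup V] [NormedSpace ℝ V]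
  [Module R V] [IsScalarTower ℝ R V] {T : V →ₗ.[R] V}

theorem quadratic_algHom_complex_apply (A : V →ₗ.[R] V) (φ : ℂ →ₐ[ℝ] ℍ[ℝ]) (z : ℂ) :
    quadratic A (φ z) = polyEval (charQuadratic z) A := by
  rw [quadratic, re_algHom_complex, norm_algHom_complex]
  have hdom (v : V) (hv : v ∈ (pow A 2).domain) : v ∈ A.domain :=
    (mem_prod_domain.1 (pow_succ_domain_le A 1 hv)).2
  refine eq_polyEval (fun v => ?_) fun v hv => ?_
  · rw [natDegree_charQuadratic]
    exact ⟨fun h => h.1.1, fun h => ⟨⟨h, hdom v h⟩, trivial⟩⟩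
  · calc (pow A 2 - (2 * z.re) • A + (‖z‖ ^ 2) • one R V) ⟨v, hv⟩
        = pow A 2 ⟨v, hv.1.1⟩ - (2 * z.re) • A ⟨v, hv.1.2⟩ + ‖z‖ ^ 2 • v := rfl
      _ = aeval (linearExtension ℝ A) (charQuadratic z) v := by
        rw [pow_apply ℝ, ← linearExtension_apply ℝ]
        rw [charQuadratic, C_mul', map_add, map_sub, map_smul, aeval_C, aeval_X_pow, aeval_X]
        rfl

theorem mem_sResolventSet_iff_boundedlyInvertible {s : ℍ[ℝ]} :
    s ∈ sResolventSet T ↔ BoundedlyInvertible (quadratic T s) :=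
  boundedlyInvertible_iff.symm

theorem algHom_complex_mem_sResolventSet (φ ψ : ℂ →ₐ[ℝ] ℍ[ℝ]) {z : ℂ} :
    φ z ∈ sResolventSet T ↔ ψ z ∈ sResolventSet T := by
  simp only [mem_sResolventSet_iff_boundedlyInvertible, quadratic_algHom_complex_apply]

theorem sSpectrum_eq_empty [Subsingleton V] (T : V →ₗ.[R] V) : sSpectrum T = ∅ := by
  refine Set.compl_empty_iff.2 (Set.eq_univ_of_forall fun s => ?_)
  exact ⟨⟨fun _ _ _ => Subsingleton.elim _ _, fun w => ⟨0, Subsingleton.elim _ _⟩⟩,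
    0, fun _ => Subsingleton.elim _ _⟩

variable [CompleteSpace V]

theorem IsClosedOp.polyEval_of_nonempty_sResolventSet (hT : IsClosedOp T)
    (hne : (sResolventSet T).Nonempty) (p : ℝ[X]) : IsClosedOp (polyEval p T) := by
  obtain ⟨s, hs⟩ := hne
  obtain ⟨φ, z, rfl⟩ := exists_algHom_complex_apply_eq s
  rw [mem_sResolventSet_iff_boundedlyInvertible, quadratic_algHom_complex_apply] at hs
  exact hT.polyEval_of_boundedlyInvertible (by simp [natDegree_charQuadratic]) hs p

theorem mem_sResolventSet_polyEval_iff_bijective (hT : IsClosedOp T)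
    (hne : (sResolventSet T).Nonempty) {p : ℝ[X]} {φ : ℂ →ₐ[ℝ] ℍ[ℝ]} {z : ℂ} :
    φ z ∈ sResolventSet (polyEval p T) ↔ Bijective (polyEval ((charQuadratic z).comp p) T) := by
  rw [mem_sResolventSet_iff_boundedlyInvertible, quadratic_algHom_complex_apply, polyEval_polyEval]
  exact ⟨BoundedlyInvertible.bijective,
    (hT.polyEval_of_nonempty_sResolventSet hne _).boundedlyInvertible ℝ⟩

theorem mem_sResolventSet_iff_bijective (hT : IsClosedOp T)
    (hne : (sResolventSet T).Nonempty) {φ : ℂ →ₐ[ℝ] ℍ[ℝ]} {z : ℂ} :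
    φ z ∈ sResolventSet T ↔ Bijective (polyEval (charQuadratic z) T) := by
  simpa [polyEval_X] using mem_sResolventSet_polyEval_iff_bijective hT hne (p := X)

theorem mem_sResolventSet_polyEval_iff_of_ne (hT : IsClosedOp T) (hne : (sResolventSet T).Nonempty)
    {p : ℝ[X]} {z : ℂ} (hpz : p.map (algebraMap ℝ ℂ) ≠ C z) {φ : ℂ →ₐ[ℝ] ℍ[ℝ]} :
    φ z ∈ sResolventSet (polyEval p T) ↔ ∀ w, aeval w p = z → φ w ∈ sResolventSet T := by
  set f := p.map (algebraMap ℝ ℂ) - C z with hf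
  have hf0 : f ≠ 0 := sub_ne_zero.2 hpz
  have hlead : ‖f.leadingCoeff‖ ^ 2 ≠ 0 := by simpa using hf0
  have hmem : (0 : ℝ[X]) ∉ f.roots.map charQuadratic := by simp [charQuadratic_ne_zero]
  have hroots (w : ℂ) : w ∈ f.roots ↔ aeval w p = z := by
    rw [mem_roots hf0, hf, IsRoot, eval_sub, eval_C, sub_eq_zero, eval_map_algebraMap]
  rw [mem_sResolventSet_polyEval_iff_bijective hT hne, charQuadratic_comp, ← hf,
    bijective_polyEval_mul (C_ne_zero.2 hlead) (Multiset.prod_ne_zero hmem),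
    and_iff_right (bijective_polyEval_C hlead T), bijective_polyEval_multiset_prod hmem]
  simp only [Multiset.forall_mem_map_iff, hroots, mem_sResolventSet_iff_bijective hT hne]

theorem mem_sResolventSet_polyEval_iff (hT : IsClosedOp T) (hne : (sResolventSet T).Nonempty)
    {p : ℝ[X]} (hp : 1 ≤ p.natDegree ∨ (sSpectrum T).Nonempty) {φ : ℂ →ₐ[ℝ] ℍ[ℝ]} {z : ℂ} :
    φ z ∈ sResolventSet (polyEval p T) ↔ ∀ w, aeval w p = z → φ w ∈ sResolventSet T := by
  rcases ne_or_eq (p.map (algebraMap ℝ ℂ)) (C z) with hpz | hpz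
  · exact mem_sResolventSet_polyEval_iff_of_ne hT hne hpz
  have hdeg : p.natDegree = 0 := by rw [← natDegree_map (algebraMap ℝ ℂ), hpz, natDegree_C]
  obtain ⟨s, hs⟩ := hp.resolve_left (by simp [hdeg])
  refine iff_of_false (fun hz => ?_) fun h => ?_
  · rw [mem_sResolventSet_polyEval_iff_bijective hT hne, charQuadratic_comp, hpz, sub_self,
      leadingCoeff_zero, norm_zero, zero_pow two_ne_zero, C_0, zero_mul] at hz
    have := subsingleton_of_injective_polyEval_zero hz.injective
    exact (sSpectrum_eq_empty T).subset hs
  · obtain ⟨ψ, w, rfl⟩ := exists_algHom_complex_apply_eq s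
    have hw : aeval w p = z := by rw [← eval_map_algebraMap, hpz, eval_C]
    exact hs ((algHom_complex_mem_sResolventSet φ ψ).1 (h w hw))

theorem image_sSpectrum_eq (hT : IsClosedOp T) (hne : (sResolventSet T).Nonempty) {p : ℝ[X]}
    (hp : 1 ≤ p.natDegree ∨ (sSpectrum T).Nonempty) :
    (fun q => aeval q p) '' sSpectrum T = sSpectrum (polyEval p T) := by
  have hmem {φ : ℂ →ₐ[ℝ] ℍ[ℝ]} {z : ℂ} :
      φ z ∈ sSpectrum (polyEval p T) ↔ ∃ w, aeval w p = z ∧ φ w ∈ sSpectrum T := by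
    simp only [sSpectrum, Set.mem_compl_iff, mem_sResolventSet_polyEval_iff hT hne hp, not_forall,
      exists_prop]
  refine Set.Subset.antisymm ?_ fun s hs => ?_
  · rintro _ ⟨q, hq, rfl⟩
    obtain ⟨φ, w, rfl⟩ := exists_algHom_complex_apply_eq q
    simp only [aeval_algHom_apply]
    exact hmem.2 ⟨w, rfl, hq⟩
  · obtain ⟨φ, z, rfl⟩ := exists_algHom_complex_apply_eq s
    obtain ⟨w, rfl, hw⟩ := hmem.1 hs
    exact ⟨φ w, hw, aeval_algHom_apply φ w p⟩

end SSpectrum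

section SidedEvaluation

open Polynomial

variable {R S V : Type*} [Ring R] [AddCommGroup V] [Module R V] [Monoid S]
  [DistribMulAction S V] [SMulCommClass R S V]

/-- `P(T)` on `D(T ^ deg P)` for a quaternionic polynomial `P` whose coefficients `a` multiply
vectors through the action of `c a`. `evalRight` is the case of the identity `c : ℍ → ℍ`,
`evalLeft` that of `MulOpposite.op : ℍ → ℍᵐᵒᵖ`. -/
noncomputable def evalVia (c : ℍ[ℝ] → S) (P : ℍ[ℝ][X]) (T : V →ₗ.[R] V) : V →ₗ.[R] V :=
  polySum P.natDegree (fun l => c (P.coeff l)) T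

theorem evalVia_map_algebraMap [Algebra ℝ R] [Module ℝ V] [IsScalarTower ℝ R V] {c : ℍ[ℝ] → S}
    (hc : ∀ (r : ℝ) (v : V), c (algebraMap ℝ ℍ[ℝ] r) • v = r • v) (p : ℝ[X]) (T : V →ₗ.[R] V) :
    evalVia c (p.map (algebraMap ℝ ℍ[ℝ])) T = polyEval p T := by
  rw [evalVia, polyEval, natDegree_map, polySum, polySum]
  refine Finset.sum_congr rfl fun l _ => LinearPMap.ext rfl fun v _ _ => ?_
  rw [LinearPMap.smul_apply, LinearPMap.smul_apply, coeff_map, hc]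

end SidedEvaluation

end UnboundedOp

open UnboundedOp Polynomial in
theorem proposition3p10_general {R S V : Type*} [Ring R] [Algebra ℝ R] [NormedAddCommGroup V]
    [NormedSpace ℝ V] [CompleteSpace V] [Module R V] [IsScalarTower ℝ R V] [Monoid S]
    [DistribMulAction S V] [SMulCommClass R S V] {c : ℍ[ℝ] → S}
    (hc : ∀ (r : ℝ) (v : V), c (algebraMap ℝ ℍ[ℝ] r) • v = r • v)
    {P Q : ℍ[ℝ][X]} (hP : IsIntrinsicPolynomial P) (hQ : IsIntrinsicPolynomial Q)
    (T : V →ₗ.[R] V) :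
    (P ≠ 0 → prod (evalVia c P T) (evalVia c Q T) = evalVia c (P * Q) T) ∧
    (Injective (evalVia c P T) → Q ≠ 0 →
      (evalVia c P T).inverse.domain ⊓ (evalVia c Q T).domain
        ≤ (prod (evalVia c P T).inverse (evalVia c Q T)).domain
          ⊓ (prod (evalVia c Q T) (evalVia c P T).inverse).domain ∧
      ∀ (v : V) (h₁ : v ∈ (prod (evalVia c P T).inverse (evalVia c Q T)).domain)
        (h₂ : v ∈ (prod (evalVia c Q T) (evalVia c P T).inverse).domain),
        v ∈ (evalVia c Q T).domain → v ∈ (evalVia c P T).inverse.domain →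
        prod (evalVia c P T).inverse (evalVia c Q T) ⟨v, h₁⟩
          = prod (evalVia c Q T) (evalVia c P T).inverse ⟨v, h₂⟩) ∧
    (IsClosedOp T → (sResolventSet T).Nonempty →
      IsClosedOp (evalVia c P T) ∧
      (1 ≤ P.natDegree ∨ (sSpectrum T).Nonempty →
        (fun q => P.eval q) '' sSpectrum T = sSpectrum (evalVia c P T))) := by
  obtain ⟨p, rfl⟩ := hP.exists_map_algebraMap_eq
  obtain ⟨q, rfl⟩ := hQ.exists_map_algebraMap_eq
  rw [← Polynomial.map_mul, evalVia_map_algebraMap hc p, evalVia_map_algebraMap hc q,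
    evalVia_map_algebraMap hc (p * q)]
  simp only [natDegree_map, ne_eq, Polynomial.map_eq_zero, eval_map_algebraMap]
  refine ⟨fun hp => prod_polyEval (.inl hp) T, fun hinj hq => ?_, fun hT hne => ?_⟩
  · have hcomm := prod_polyEval_comm_of_injective hq hinj
    exact ⟨inverse_domain_inf_domain_le hinj hcomm,
      fun v h₁ h₂ hvQ hvP => inverse_prod_apply_eq hinj hcomm ⟨hvP, hvQ⟩ h₁ h₂⟩
  · exact ⟨hT.polyEval_of_nonempty_sResolventSet hne p, image_sSpectrum_eq hT hne⟩

theorem proposition3p10 {V : Type*} [NormedAddCommGroup V] [NormedSpace ℝ V] [CompleteSpace V]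
    [Module ℍ[ℝ] V] [Module ℍ[ℝ]ᵐᵒᵖ V] [SMulCommClass ℍ[ℝ] ℍ[ℝ]ᵐᵒᵖ V]
    [SMulCommClass ℍ[ℝ]ᵐᵒᵖ ℍ[ℝ] V]
    [IsScalarTower ℝ ℍ[ℝ] V] [IsScalarTower ℝ ℍ[ℝ]ᵐᵒᵖ V]
    [ContinuousSMul ℍ[ℝ] V] [ContinuousSMul ℍ[ℝ]ᵐᵒᵖ V]
    (P Q : ℍ[ℝ][X]) (hP : IsIntrinsicPolynomial P) (hQ : IsIntrinsicPolynomial Q) :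
    -- right linear operators
    (∀ T : V →ₗ.[ℍ[ℝ]ᵐᵒᵖ] V,
      (P ≠ 0 → UnboundedOp.prod (UnboundedOp.evalRight P T) (UnboundedOp.evalRight Q T)
        = UnboundedOp.evalRight (P * Q) T) ∧
      (UnboundedOp.Injective (UnboundedOp.evalRight P T) → Q ≠ 0 →
        (UnboundedOp.evalRight P T).inverse.domain ⊓ (UnboundedOp.evalRight Q T).domain
            ≤ (UnboundedOp.prod (UnboundedOp.evalRight P T).inverse
                (UnboundedOp.evalRight Q T)).domain
              ⊓ (UnboundedOp.prod (UnboundedOp.evalRight Q T)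
                (UnboundedOp.evalRight P T).inverse).domain ∧
        ∀ (v : V)
          (h₁ : v ∈ (UnboundedOp.prod (UnboundedOp.evalRight P T).inverse
            (UnboundedOp.evalRight Q T)).domain)
          (h₂ : v ∈ (UnboundedOp.prod (UnboundedOp.evalRight Q T)
            (UnboundedOp.evalRight P T).inverse).domain),
          v ∈ (UnboundedOp.evalRight Q T).domain →
          v ∈ (UnboundedOp.evalRight P T).inverse.domain →
          UnboundedOp.prod (UnboundedOp.evalRight P T).inverse
              (UnboundedOp.evalRight Q T) ⟨v, h₁⟩
            = UnboundedOp.prod (UnboundedOp.evalRight Q T)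
              (UnboundedOp.evalRight P T).inverse ⟨v, h₂⟩) ∧
      (UnboundedOp.IsClosedOp T → (UnboundedOp.sResolventSet T).Nonempty →
        UnboundedOp.IsClosedOp (UnboundedOp.evalRight P T) ∧
        ((1 ≤ P.natDegree ∨ (UnboundedOp.sSpectrum T).Nonempty) →
          (fun q => P.eval q) '' UnboundedOp.sSpectrum T
            = UnboundedOp.sSpectrum (UnboundedOp.evalRight P T)))) ∧
    -- left linear operators
    (∀ T : V →ₗ.[ℍ[ℝ]] V,
      (P ≠ 0 → UnboundedOp.prod (UnboundedOp.evalLeft P T) (UnboundedOp.evalLeft Q T)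
        = UnboundedOp.evalLeft (P * Q) T) ∧
      (UnboundedOp.Injective (UnboundedOp.evalLeft P T) → Q ≠ 0 →
        (UnboundedOp.evalLeft P T).inverse.domain ⊓ (UnboundedOp.evalLeft Q T).domain
            ≤ (UnboundedOp.prod (UnboundedOp.evalLeft P T).inverse
                (UnboundedOp.evalLeft Q T)).domain
              ⊓ (UnboundedOp.prod (UnboundedOp.evalLeft Q T)
                (UnboundedOp.evalLeft P T).inverse).domain ∧
        ∀ (v : V)
          (h₁ : v ∈ (UnboundedOp.prod (UnboundedOp.evalLeft P T).inverse
            (UnboundedOp.evalLeft Q T)).domain)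
          (h₂ : v ∈ (UnboundedOp.prod (UnboundedOp.evalLeft Q T)
            (UnboundedOp.evalLeft P T).inverse).domain),
          v ∈ (UnboundedOp.evalLeft Q T).domain →
          v ∈ (UnboundedOp.evalLeft P T).inverse.domain →
          UnboundedOp.prod (UnboundedOp.evalLeft P T).inverse
              (UnboundedOp.evalLeft Q T) ⟨v, h₁⟩
            = UnboundedOp.prod (UnboundedOp.evalLeft Q T)
              (UnboundedOp.evalLeft P T).inverse ⟨v, h₂⟩) ∧
      (UnboundedOp.IsClosedOp T → (UnboundedOp.sResolventSet T).Nonempty →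
        UnboundedOp.IsClosedOp (UnboundedOp.evalLeft P T) ∧
        ((1 ≤ P.natDegree ∨ (UnboundedOp.sSpectrum T).Nonempty) →
          (fun q => P.eval q) '' UnboundedOp.sSpectrum T
            = UnboundedOp.sSpectrum (UnboundedOp.evalLeft P T)))) := by
  constructor
  · exact proposition3p10_general (c := id) (fun r v => algebraMap_smul ℍ[ℝ] r v) hP hQ
  · exact proposition3p10_general (c := MulOpposite.op)
      (fun r v => algebraMap_smul ℍ[ℝ]ᵐᵒᵖ r v) hP hQ
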